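/- Let $\mathrm{Av}(4123,1324)$ be the class of all permutations (of all lengths $n\ge 0$, including the empty permutation) that contain neither $4123$ nor $1324$ as a pattern; that is, no subsequence of four entries has the same relative order as $4,1,2,3$ or as $1,3,2,4$. Let $\mathcal P_1(z)=\sum_{n\ge 0} p_n z^n$ be its generating function, where $p_n$ is the number of permutations of length $n$ in the class. Then, as an identity of formal power series over $\mathbb Q$, $$\mathcal P_1(z)=\frac{2-13z+26z^2-17z^3+4z^4-z(1-2z-z^2)\sqrt{1-4z}}{2\sqrt{1-4z}\,(1-3z+z^2)^2},$$ where $\sqrt{1-4z}$ denotes the power series with constant term $1$ whose square is $1-4z$. In particular, $\mathcal P_1(z)$ is algebraic of degree exactly two over $\mathbb Q(z)$. -/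

import Mathlib

open PowerSeries

namespace PermClass

/-- A permutation of some finite length `n`, viewed as a word `σ 0, σ 1, …, σ (n - 1)` in which
each of the values `0, …, n - 1` occurs once. -/
abbrev FinPerm : Type := Σ n : ℕ, Equiv.Perm (Fin n)

/-- `σ` contains the pattern `π`: some subsequence of `σ` is in the same relative order as `π`. -/
def Contains {n k : ℕ} (σ : Equiv.Perm (Fin n)) (π : Equiv.Perm (Fin k)) : Prop :=
  ∃ f : Fin k → Fin n, StrictMono f ∧ ∀ i j : Fin k, σ (f i) < σ (f j) ↔ π i < π j

/-- The class `Av(B)` of all permutations that contain no pattern from `B`. -/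
def Av (B : Set FinPerm) : Set FinPerm :=
  {σ | ∀ π ∈ B, ¬ Contains σ.2 π.2}

/-- The generating function `∑ₙ |C ∩ Sₙ| zⁿ` of a set `C` of permutations, as a formal power
series. -/
noncomputable def genFun (C : Set FinPerm) : PowerSeries ℚ :=
  PowerSeries.mk fun n => (Nat.card {σ : Equiv.Perm (Fin n) // (⟨n, σ⟩ : FinPerm) ∈ C} : ℚ)

/-- The formal power series `f` is algebraic of degree `d` over the field `ℚ(z)`: `d` is the least
degree in `Y` of a nonzero polynomial `Q ∈ ℚ[z][Y]` with `Q(f) = 0` (denominators cleared). -/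
def IsAlgebraicOfDegree (f : PowerSeries ℚ) (d : ℕ) : Prop :=
  IsLeast {k : ℕ | ∃ Q : Polynomial (Polynomial ℚ),
    Q ≠ 0 ∧ Q.natDegree = k ∧ Polynomial.aeval f Q = 0} d

/-- The permutation with one-line notation `4123` (values and positions counted from `0`). -/
def p4123 : FinPerm :=
  ⟨4, { toFun := ![3, 0, 1, 2]
        invFun := ![1, 2, 3, 0]
        left_inv := by decide
        right_inv := by decide }⟩

/-- The permutation with one-line notation `1324` (values and positions counted from `0`). -/
def p1324 : FinPerm :=
  ⟨4, { toFun := ![0, 2, 1, 3]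
        invFun := ![0, 2, 1, 3]
        left_inv := by decide
        right_inv := by decide }⟩

/-- The formal power series `√(1 - 4z)`: the binomial series `(1 + z)^(1/2)` at `-4z`. -/
noncomputable def sqrtOneSubFour : PowerSeries ℚ :=
  PowerSeries.rescale (-4 : ℚ) (PowerSeries.binomialSeries ℚ (1 / 2 : ℚ))

theorem sqrtOneSubFour_sq : sqrtOneSubFour ^ 2 = 1 - 4 * (X : PowerSeries ℚ) := by
  have h := PowerSeries.binomialSeries_nat (R := ℚ) (A := ℚ) 1
  rw [sqrtOneSubFour, ← map_pow, sq, ← PowerSeries.binomialSeries_add,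
    show (1 / 2 : ℚ) + 1 / 2 = ((1 : ℕ) : ℚ) by norm_num, h, pow_one, map_add, map_one,
    PowerSeries.rescale_X, map_neg, show (C (4 : ℚ) : PowerSeries ℚ) = 4 from map_ofNat _ 4]
  ring

theorem constantCoeff_sqrtOneSubFour : constantCoeff sqrtOneSubFour = 1 := by
  rw [← PowerSeries.coeff_zero_eq_constantCoeff_apply, sqrtOneSubFour, PowerSeries.coeff_rescale]
  simp

end PermClass

/-!
The class `Av(4123, 1324)` is enumerated by a generating tree with one catalytic parameter and the
kernel method.

*The tree.* Every permutation of length `n + 1` arises from a unique permutation `σ` of length `n`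
by appending a last value `v ∈ {0, …, n}` (`insertLast`). The site `v` is active if this stays in
the class; let `k` be the number of active sites. Appending `v` keeps all active sites below `v`,
and appending `0` yields `k + 1` active sites. For `v > 0` at most one site `w` above `v` survives
(`card_bonus_le_one`). Without these bonus sites the labels follow the Catalan rule
`k ↦ 2, …, k + 1`. So for a weight `u`, the sums `φₙ` of `u ^ k` over the permutations of length
`n` in the class satisfy `(u - 1) φₙ₊₁ = u² φₙ - u² pₙ + (u - 1)² bₙ`, with `bₙ` the contribution
of the bonus sites (`siteSum_succ`). Taking for `u` the Catalan series `c`, for which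
`X c² = c - 1`, cancels the unknown `∑ φₙ Xⁿ` and leaves `∑ pₙ Xⁿ = c + X (c - 1) ∑ bₙ Xⁿ`.

*The bonus sites.* A bonus site `w` for `(σ, v)` forces a direct sum `σ = S ⊕ Q` with `|S| = w`,
where `S` avoids `132` even after `v` is appended, and `Q` avoids `213`
(`bonus_directSum_iff`, `exists_eq_directSum_of_survives`). So `∑ bₙ Xⁿ` is a product. The factor
counting the `Q` is the generating function of `Av(4123, 213)`, which equals that of
`Av(4123, 132)` by reversing, complementing and inverting. The factor for the pairs `(S, v)` comes
from the same generating tree restricted to `Av(4123, 132)`, where a value that is neither the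
smallest nor the largest one can be appended only if the last entry is the minimum
(`last_eq_zero_of_act132`); this gives linear recurrences.

*The degree.* The closed form has the shape `√(1 - 4X) (d f + b) = a` with polynomials `a`, `b`, `d`,
so `f` is a root of a quadratic; it is not rational because `1 - 4X` has odd degree.
-/

namespace PermClass

open Finset

/-! ### Appending a last entry -/

/-- The permutation of length `n + 1` whose last entry is `v` and whose first `n` entries are in
the same relative order as `σ`. -/
def insertLast {n : ℕ} (v : Fin (n + 1)) (σ : Equiv.Perm (Fin n)) : Equiv.Perm (Fin (n + 1)) :=
  finSuccEquivLast.trans (σ.optionCongr.trans (finSuccEquiv' v).symm)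

@[simp] theorem insertLast_last {n : ℕ} (v : Fin (n + 1)) (σ : Equiv.Perm (Fin n)) :
    insertLast v σ (Fin.last n) = v := by
  simp [insertLast]

@[simp] theorem insertLast_castSucc {n : ℕ} (v : Fin (n + 1)) (σ : Equiv.Perm (Fin n))
    (i : Fin n) : insertLast v σ i.castSucc = v.succAbove (σ i) := by
  simp [insertLast]

theorem insertLast_bijective (n : ℕ) : Function.Bijective
    fun p : Fin (n + 1) × Equiv.Perm (Fin n) => insertLast p.1 p.2 := by
  rw [Fintype.bijective_iff_injective_and_card]
  refine ⟨?_, by simp [Fintype.card_perm, Nat.factorial_succ]⟩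
  rintro ⟨v, σ⟩ ⟨w, τ⟩ h
  have h' : ∀ i, insertLast v σ i = insertLast w τ i := fun i => DFunLike.congr_fun h i
  obtain rfl : v = w := by simpa using h' (Fin.last n)
  obtain rfl : σ = τ := by
    ext i
    exact congrArg Fin.val (v.succAbove_right_injective (by simpa using h' i.castSucc))
  rfl

theorem sum_perm_succ {M : Type*} [AddCommMonoid M] {n : ℕ} (f : Equiv.Perm (Fin (n + 1)) → M) :
    ∑ τ, f τ = ∑ σ : Equiv.Perm (Fin n), ∑ v : Fin (n + 1), f (insertLast v σ) := by
  rw [← (insertLast_bijective n).sum_comp f, Fintype.sum_prod_type, Finset.sum_comm]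

theorem val_succAbove {n : ℕ} (v : Fin (n + 1)) (x : Fin n) :
    (v.succAbove x : ℕ) = if (x : ℕ) < v then (x : ℕ) else x + 1 := by
  by_cases h : (x : ℕ) < v
  · rw [if_pos h, Fin.succAbove_of_castSucc_lt _ _ (by simpa [Fin.lt_def] using h)]; rfl
  · rw [if_neg h, Fin.succAbove_of_le_castSucc _ _ (by simpa [Fin.le_def] using h)]; rfl

/-! ### Pattern avoidance in terms of entries -/

variable {n : ℕ}

/-- Containment of `1324`, spelled out. -/
def Has1324 (σ : Equiv.Perm (Fin n)) : Prop :=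
  ∃ i j k l, i < j ∧ j < k ∧ k < l ∧ σ i < σ k ∧ σ k < σ j ∧ σ j < σ l

/-- Containment of `4123`, spelled out. -/
def Has4123 (σ : Equiv.Perm (Fin n)) : Prop :=
  ∃ i j k l, i < j ∧ j < k ∧ k < l ∧ σ j < σ k ∧ σ k < σ l ∧ σ l < σ i

/-- Containment of `132`, spelled out. -/
def Has132 (σ : Equiv.Perm (Fin n)) : Prop :=
  ∃ i j k, i < j ∧ j < k ∧ σ i < σ k ∧ σ k < σ j

/-- Containment of `213`, spelled out. -/
def Has213 (σ : Equiv.Perm (Fin n)) : Prop :=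
  ∃ i j k, i < j ∧ j < k ∧ σ j < σ i ∧ σ i < σ k

/-- Membership in `Av(4123, 1324)`. -/
def Good (σ : Equiv.Perm (Fin n)) : Prop := ¬ Has1324 σ ∧ ¬ Has4123 σ

/-- Membership in `Av(4123, 132)`. -/
def Good132 (σ : Equiv.Perm (Fin n)) : Prop := ¬ Has132 σ ∧ ¬ Has4123 σ

/-- Membership in `Av(4123, 213)`. -/
def Good213 (σ : Equiv.Perm (Fin n)) : Prop := ¬ Has213 σ ∧ ¬ Has4123 σ

theorem contains_iff_has1324 (σ : Equiv.Perm (Fin n)) (π : Equiv.Perm (Fin 4))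
    (hπ : ⇑π = ![0, 2, 1, 3]) : Contains σ π ↔ Has1324 σ := by
  simp only [Contains, hπ]
  constructor
  · rintro ⟨f, hf, h⟩
    exact ⟨f 0, f 1, f 2, f 3, hf (by decide), hf (by decide), hf (by decide),
      (h 0 2).2 (by decide), (h 2 1).2 (by decide), (h 1 3).2 (by decide)⟩
  · rintro ⟨i, j, k, l, hij, hjk, hkl, h1, h2, h3⟩
    refine ⟨![i, j, k, l], ?_, ?_⟩
    · rw [Fin.strictMono_iff_lt_succ]
      intro a
      fin_cases a <;> simpa
    · intro a b
      fin_cases a <;> fin_cases b <;> simp <;> order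

theorem contains_iff_has4123 (σ : Equiv.Perm (Fin n)) (π : Equiv.Perm (Fin 4))
    (hπ : ⇑π = ![3, 0, 1, 2]) : Contains σ π ↔ Has4123 σ := by
  simp only [Contains, hπ]
  constructor
  · rintro ⟨f, hf, h⟩
    exact ⟨f 0, f 1, f 2, f 3, hf (by decide), hf (by decide), hf (by decide),
      (h 1 2).2 (by decide), (h 2 3).2 (by decide), (h 3 0).2 (by decide)⟩
  · rintro ⟨i, j, k, l, hij, hjk, hkl, h1, h2, h3⟩
    refine ⟨![i, j, k, l], ?_, ?_⟩
    · rw [Fin.strictMono_iff_lt_succ]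
      intro a
      fin_cases a <;> simpa
    · intro a b
      fin_cases a <;> fin_cases b <;> simp <;> order

theorem mem_Av_iff (σ : Equiv.Perm (Fin n)) :
    (⟨n, σ⟩ : FinPerm) ∈ Av {p4123, p1324} ↔ Good σ := by
  have h1 := contains_iff_has4123 σ p4123.2 rfl
  have h2 := contains_iff_has1324 σ p1324.2 rfl
  constructor
  · intro h
    exact ⟨fun h' => h p1324 (by simp) (h2.2 h'), fun h' => h p4123 (by simp) (h1.2 h')⟩
  · rintro ⟨g2, g1⟩ π (rfl | rfl)
    · exact fun h => g1 (h1.1 h)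
    · exact fun h => g2 (h2.1 h)

theorem exists_fin_succ_last {P : Fin (n + 1) → Prop} :
    (∃ i, P i) ↔ (∃ i : Fin n, P i.castSucc) ∨ P (Fin.last n) := by
  constructor
  · rintro ⟨i, hi⟩
    induction i using Fin.lastCases with
    | last => exact Or.inr hi
    | cast i => exact Or.inl ⟨i, hi⟩
  · rintro (⟨i, hi⟩ | h)
    exacts [⟨_, hi⟩, ⟨_, h⟩]

theorem succAbove_lt_iff (v : Fin (n + 1)) (x : Fin n) : v.succAbove x < v ↔ (x : ℕ) < v := by
  rw [Fin.lt_def, val_succAbove]; split_ifs <;> omega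

theorem lt_succAbove_iff' (v : Fin (n + 1)) (x : Fin n) : v < v.succAbove x ↔ (v : ℕ) ≤ x := by
  rw [Fin.lt_def, val_succAbove]; split_ifs <;> omega

theorem has132_insertLast (v : Fin (n + 1)) (σ : Equiv.Perm (Fin n)) :
    Has132 (insertLast v σ) ↔
      Has132 σ ∨ ∃ i j, i < j ∧ (σ i : ℕ) < v ∧ (v : ℕ) ≤ σ j := by
  simp [Has132, exists_fin_succ_last, Fin.not_lt.2 (Fin.le_last _), succAbove_lt_iff,
    lt_succAbove_iff', exists_or, -exists_and_left]

theorem has1324_insertLast (v : Fin (n + 1)) (σ : Equiv.Perm (Fin n)) :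
    Has1324 (insertLast v σ) ↔
      Has1324 σ ∨ ∃ i j k, i < j ∧ j < k ∧ σ i < σ k ∧ σ k < σ j ∧ (σ j : ℕ) < v := by
  simp [Has1324, exists_fin_succ_last, Fin.not_lt.2 (Fin.le_last _), succAbove_lt_iff,
    lt_succAbove_iff', exists_or, -exists_and_left]

theorem has4123_insertLast (v : Fin (n + 1)) (σ : Equiv.Perm (Fin n)) :
    Has4123 (insertLast v σ) ↔
      Has4123 σ ∨ ∃ i j k, i < j ∧ j < k ∧ σ j < σ k ∧ (σ k : ℕ) < v ∧ (v : ℕ) ≤ σ i := by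
  simp [Has4123, exists_fin_succ_last, Fin.not_lt.2 (Fin.le_last _), succAbove_lt_iff,
    lt_succAbove_iff', exists_or, -exists_and_left]

/-- For `σ` in `Av(4123, 1324)`: appending the value `v` to `σ` stays in the class. -/
def Act (σ : Equiv.Perm (Fin n)) (v : ℕ) : Prop :=
  (∀ i j k, i < j → j < k → σ i < σ k → σ k < σ j → v ≤ σ j) ∧
    ∀ i j k, i < j → j < k → σ j < σ k → (σ k : ℕ) < v → (σ i : ℕ) < v

/-- For `σ` in `Av(4123, 132)`: appending the value `v` to `σ` stays in the class. -/
def Act132 (σ : Equiv.Perm (Fin n)) (v : ℕ) : Prop :=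
  (∀ i j, i < j → (σ i : ℕ) < v → (σ j : ℕ) < v) ∧
    ∀ i j k, i < j → j < k → σ j < σ k → (σ k : ℕ) < v → (σ i : ℕ) < v

/-- The condition under which a site `w ≥ v` of `σ` survives the appending of the value `v`:
entries that follow an entry below `v` avoid the values from `v` to `w - 1`, and entries followed
by an entry below `v` avoid the values from `w` on. -/
def Survives (σ : Equiv.Perm (Fin n)) (v w : ℕ) : Prop :=
  (∀ i j, i < j → (σ i : ℕ) < v → v ≤ σ j → w ≤ σ j) ∧
    ∀ i j, i < j → (σ j : ℕ) < v → v ≤ σ i → (σ i : ℕ) < w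

theorem good_insertLast (v : Fin (n + 1)) (σ : Equiv.Perm (Fin n)) :
    Good (insertLast v σ) ↔ Good σ ∧ Act σ v := by
  rw [Good, has1324_insertLast, has4123_insertLast, Good, Act]
  push Not
  exact ⟨fun ⟨⟨a, b⟩, c, d⟩ => ⟨⟨a, c⟩, b, d⟩, fun ⟨⟨a, c⟩, b, d⟩ => ⟨⟨a, b⟩, c, d⟩⟩

theorem good132_insertLast (v : Fin (n + 1)) (σ : Equiv.Perm (Fin n)) :
    Good132 (insertLast v σ) ↔ Good132 σ ∧ Act132 σ v := by
  rw [Good132, has132_insertLast, has4123_insertLast, Good132, Act132]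
  push Not
  exact ⟨fun ⟨⟨a, b⟩, c, d⟩ => ⟨⟨a, c⟩, b, d⟩, fun ⟨⟨a, c⟩, b, d⟩ => ⟨⟨a, b⟩, c, d⟩⟩

theorem forall_fin_succ_last {P : Fin (n + 1) → Prop} :
    (∀ i, P i) ↔ (∀ i : Fin n, P i.castSucc) ∧ P (Fin.last n) :=
  Fin.forall_fin_succ'

theorem act_insertLast_of_le (v : Fin (n + 1)) (σ : Equiv.Perm (Fin n)) {w : ℕ} (hw : w ≤ v) :
    Act (insertLast v σ) w ↔ Act σ w := by
  have h1 : ∀ x : Fin n, w ≤ (v.succAbove x : ℕ) ↔ w ≤ x := fun x => by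
    rw [val_succAbove]; split_ifs <;> omega
  have h2 : ∀ x : Fin n, (v.succAbove x : ℕ) < w ↔ (x : ℕ) < w := fun x => by
    rw [val_succAbove]; split_ifs <;> omega
  simp [Act, forall_fin_succ_last, Fin.not_lt.2 (Fin.le_last _), succAbove_lt_iff,
    lt_succAbove_iff', h1, h2, hw, hw.not_gt]
  exact fun _ => ⟨fun h i j => (h i j).1, fun h i j => ⟨h i j, fun _ _ h' => hw.trans h'⟩⟩

theorem act_insertLast_of_ge (v : Fin (n + 1)) (σ : Equiv.Perm (Fin n)) {w : ℕ} (hw : v ≤ w) :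
    Act (insertLast v σ) (w + 1) ↔ Act σ w ∧ Survives σ v w := by
  have h1 : ∀ x : Fin n, w < (v.succAbove x : ℕ) ↔ w ≤ x := fun x => by
    rw [val_succAbove]; split_ifs <;> omega
  have h2 : ∀ x : Fin n, (v.succAbove x : ℕ) ≤ w ↔ (x : ℕ) < w := fun x => by
    rw [val_succAbove]; split_ifs <;> omega
  simp [Act, Survives, forall_fin_succ_last, Fin.not_lt.2 (Fin.le_last _), succAbove_lt_iff,
    lt_succAbove_iff', h1, h2, hw]
  exact ⟨fun ⟨a, b⟩ => ⟨⟨fun i j => (a i j).1, fun i j => (b i j).1⟩, fun i j => (a i j).2,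
      fun i j h1 h2 _ => (b i j).2 h1 h2⟩,
    fun ⟨⟨a, b⟩, c, d⟩ => ⟨fun i j => ⟨a i j, c i j⟩, fun i j => ⟨b i j, fun h1 h2 =>
      (lt_or_ge (σ i : ℕ) v).elim (·.trans_le hw) (d i j h1 h2)⟩⟩⟩

/-! ### Active sites and their number after appending an entry -/

open Classical in
/-- The number of active sites `w ≤ v` of `σ`. -/
noncomputable def rank (σ : Equiv.Perm (Fin n)) (v : ℕ) : ℕ := #{w ∈ range (v + 1) | Act σ w}

/-- The number of active sites of `σ`, out of the `n + 1` sites. -/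
noncomputable def numSites (σ : Equiv.Perm (Fin n)) : ℕ := rank σ n

open Classical in
/-- The active sites of `σ` from `v` on that remain active when `v` is appended. -/
noncomputable def bonus (σ : Equiv.Perm (Fin n)) (v : ℕ) : Finset ℕ :=
  {w ∈ Icc v n | Act σ w ∧ Survives σ v w}

theorem act_zero (σ : Equiv.Perm (Fin n)) : Act σ 0 := by simp [Act]

theorem survives_zero (σ : Equiv.Perm (Fin n)) (w : ℕ) : Survives σ 0 w := by simp [Survives]

theorem act132_zero (σ : Equiv.Perm (Fin n)) : Act132 σ 0 := by simp [Act132]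

theorem act132_self (σ : Equiv.Perm (Fin n)) : Act132 σ n := by simp [Act132]

theorem rank_zero (σ : Equiv.Perm (Fin n)) : rank σ 0 = 1 := by
  simp [rank, filter_singleton, act_zero]

theorem card_bonus_zero (σ : Equiv.Perm (Fin n)) : #(bonus σ 0) = numSites σ := by
  rw [bonus, numSites, rank]
  congr 1
  ext w
  simp [survives_zero]

theorem numSites_insertLast (v : Fin (n + 1)) (σ : Equiv.Perm (Fin n)) :
    numSites (insertLast v σ) = rank σ v + #(bonus σ v) := by
  classical
  have hsplit : ({w ∈ range (n + 1 + 1) | Act (insertLast v σ) w} : Finset ℕ) =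
      {w ∈ range (v + 1) | Act σ w} ∪ (bonus σ v).map (addRightEmbedding 1) := by
    ext w
    have hv := v.2
    simp only [mem_filter, mem_range, mem_union, mem_map, addRightEmbedding_apply, bonus, mem_Icc]
    rcases le_or_gt w v with h | h
    · rw [act_insertLast_of_le v σ h]
      constructor
      · exact fun h' => Or.inl ⟨by omega, h'.2⟩
      · rintro (h' | ⟨a, ⟨ha, -⟩, rfl⟩)
        · exact ⟨by omega, h'.2⟩
        · omega
    · obtain ⟨w, rfl⟩ := Nat.exists_eq_succ_of_ne_zero (by omega : w ≠ 0)
      rw [Nat.succ_eq_add_one, act_insertLast_of_ge v σ (by omega)]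
      constructor
      · exact fun h' => Or.inr ⟨w, ⟨⟨by omega, by omega⟩, h'.2⟩, rfl⟩
      · rintro (h' | ⟨a, ⟨ha, ha'⟩, h'⟩)
        · omega
        · obtain rfl : a = w := by omega
          exact ⟨by omega, ha'⟩
  rw [numSites, rank, hsplit, card_union_of_disjoint, card_map, rank]
  rw [disjoint_left]
  simp only [mem_filter, mem_range, mem_map, addRightEmbedding_apply, bonus, mem_Icc]
  rintro w ⟨h, -⟩ ⟨a, ⟨ha, -⟩, rfl⟩
  omega

/-- For `v > 0`, at most one site above the appended value `v` stays active: of two such sites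
`w₁ < w₂`, compare the positions of the values `0` and `w₁`. -/
theorem card_bonus_le_one (σ : Equiv.Perm (Fin n)) {v : ℕ} (hv : v ≠ 0) : #(bonus σ v) ≤ 1 := by
  classical
  have key : ∀ w₁ ∈ bonus σ v, ∀ w₂ ∈ bonus σ v, ¬ w₁ < w₂ := by
    intro w₁ h₁ w₂ h₂ hlt
    simp only [bonus, mem_filter, mem_Icc] at h₁ h₂
    obtain ⟨⟨hv1, -⟩, -, -, hb⟩ := h₁
    obtain ⟨⟨-, hn⟩, -, ha, -⟩ := h₂
    obtain ⟨i, hi⟩ := σ.surjective ⟨0, by omega⟩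
    obtain ⟨j, hj⟩ := σ.surjective ⟨w₁, by omega⟩
    have hi' : (σ i : ℕ) = 0 := by rw [hi]
    have hj' : (σ j : ℕ) = w₁ := by rw [hj]
    rcases lt_trichotomy i j with h | rfl | h
    · have := ha i j h (by omega) (by omega)
      omega
    · omega
    · have := hb j i h (by omega) (by omega)
      omega
  rw [card_le_one]
  intro a ha b hb
  have := key a ha b hb
  have := key b hb a ha
  omega

section Weights

variable {R : Type*} [CommRing R]

/-- Ranking the elements of `{v < N | p v}` turns the sum into a geometric one. -/
theorem sum_pow_card_filter (p : ℕ → Prop) [DecidablePred p] (N : ℕ) (u : R) :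
    (u - 1) * ∑ v ∈ range N with p v, u ^ #{w ∈ range (v + 1) | p w} =
      u ^ (#{w ∈ range N | p w} + 1) - u := by
  induction N with
  | zero => simp
  | succ N ih =>
    rw [sum_filter] at ih ⊢
    rw [sum_range_succ, mul_add, ih]
    rw [range_add_one, filter_insert]
    by_cases h : p N
    · rw [if_pos h, if_pos h, card_insert_of_notMem (by simp)]
      ring
    · simp [h]

open Classical in
/-- The children of `σ` in the generating tree, weighted by `u` to the number of their active
sites. Without the bonus sites the labels would follow the Catalan rule. -/
theorem sum_children (σ : Equiv.Perm (Fin n)) (u : R) :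
    (u - 1) * ∑ v ∈ range (n + 1) with Act σ v, u ^ (rank σ v + #(bonus σ v)) =
      u ^ (numSites σ + 2) - u ^ 2 + (u - 1) ^ 2 *
        ∑ v ∈ range (n + 1) with Act σ v ∧ v ≠ 0, ∑ _w ∈ bonus σ v, u ^ rank σ v := by
  have h := sum_pow_card_filter (Act σ) (n + 1) u
  change (u - 1) * ∑ v ∈ range (n + 1) with Act σ v, u ^ rank σ v = u ^ (numSites σ + 1) - u at h
  rw [sum_filter, sum_range_succ'] at h ⊢
  rw [sum_filter, sum_range_succ']
  simp only [act_zero, if_true, rank_zero, card_bonus_zero, ne_eq, not_true, and_false, if_false,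
    Nat.add_eq_zero_iff, one_ne_zero, not_false_iff, and_true, add_zero] at h ⊢
  have h2 : ∑ v ∈ range n, (if Act σ (v + 1) then u ^ (rank σ (v + 1) + #(bonus σ (v + 1))) else 0)
      = ∑ v ∈ range n, (if Act σ (v + 1) then u ^ rank σ (v + 1) else 0) + (u - 1) *
        ∑ v ∈ range n,
          (if Act σ (v + 1) then ∑ _w ∈ bonus σ (v + 1), u ^ rank σ (v + 1) else 0) := by
    rw [mul_sum, ← sum_add_distrib]
    refine sum_congr rfl fun v _ => ?_
    split_ifs with hv
    · have := card_bonus_le_one σ (Nat.succ_ne_zero v)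
      rw [Nat.succ_eq_add_one] at this
      rw [sum_const]
      interval_cases h : #(bonus σ (v + 1))
      · simp
      · simp; ring
    · simp
  rw [h2]
  linear_combination h

open Classical in
/-- `∑ u ^ (number of active sites)` over `Av(4123, 1324)` in length `n`. -/
noncomputable def siteSum (n : ℕ) (u : R) : R :=
  ∑ σ : Equiv.Perm (Fin n) with Good σ, u ^ numSites σ

open Classical in
/-- The total contribution of the bonus sites to the children of the permutations of length `n` in
`Av(4123, 1324)`. -/
noncomputable def bonusSum (n : ℕ) (u : R) : R :=
  ∑ σ : Equiv.Perm (Fin n) with Good σ,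
    ∑ v ∈ range (n + 1) with Act σ v ∧ v ≠ 0, ∑ _w ∈ bonus σ v, u ^ rank σ v

open Classical in
theorem siteSum_zero (u : R) : siteSum 0 u = u := by
  have : ∀ σ : Equiv.Perm (Fin 0), Good σ := fun σ =>
    ⟨fun ⟨i, _⟩ => i.elim0, fun ⟨i, _⟩ => i.elim0⟩
  simp [siteSum, this, numSites, rank_zero]

open Classical in
/-- The functional equation of the generating tree, coefficient by coefficient. -/
theorem siteSum_succ (n : ℕ) (u : R) :
    (u - 1) * siteSum (n + 1) u = u ^ 2 * siteSum n u
      - u ^ 2 * (#{σ : Equiv.Perm (Fin n) | Good σ} : R) + (u - 1) ^ 2 * bonusSum n u := by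
  have h : siteSum (n + 1) u = ∑ σ : Equiv.Perm (Fin n) with Good σ,
      ∑ v ∈ range (n + 1) with Act σ v, u ^ (rank σ v + #(bonus σ v)) := by
    rw [siteSum, sum_filter, sum_perm_succ, sum_filter]
    refine sum_congr rfl fun σ _ => ?_
    simp only [good_insertLast, numSites_insertLast]
    rw [Fin.sum_univ_eq_sum_range
      (fun v => if Good σ ∧ Act σ v then u ^ (rank σ v + #(bonus σ v)) else 0)]
    by_cases hσ : Good σ <;> simp [hσ, sum_filter]
  rw [h, mul_sum, sum_congr rfl fun σ _ => sum_children σ u, siteSum, bonusSum, sum_add_distrib,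
    sum_sub_distrib, mul_sum, mul_sum, sum_const, nsmul_eq_mul]
  simp only [pow_add]
  simp only [mul_comm]

/-! ### The class `Av(4123, 132)` -/

open Classical in
/-- `∑ u ^ (number of active sites)` over `Av(4123, 132)` in length `n`. -/
noncomputable def siteSum132 (n : ℕ) (u : R) : R :=
  ∑ σ : Equiv.Perm (Fin n) with Good132 σ, u ^ numSites σ

open Classical in
/-- `∑ u ^ rank σ v` over the pairs `(σ, v)`, where `σ` in `Av(4123, 132)` has length `n` and stays
in that class when the nonzero value `v` is appended. -/
noncomputable def extSum132 (n : ℕ) (u : R) : R :=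
  ∑ σ : Equiv.Perm (Fin n) with Good132 σ,
    ∑ v ∈ range (n + 1) with Act132 σ v ∧ v ≠ 0, u ^ rank σ v

open Classical in
/-- The part of `extSum132` with `v` not the largest possible value. -/
noncomputable def innerSum132 (n : ℕ) (u : R) : R :=
  ∑ σ : Equiv.Perm (Fin n) with Good132 σ,
    ∑ v ∈ range n with Act132 σ v ∧ v ≠ 0, u ^ rank σ v

theorem card_bonus_of_act132 {σ : Equiv.Perm (Fin n)} (hσ : Good132 σ) {v : ℕ} (hn : v ≤ n)
    (hv : v ≠ 0) (h : Act132 σ v) : #(bonus σ v) = 1 := by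
  classical
  refine le_antisymm (card_bonus_le_one σ hv) (card_pos.2 ⟨n, ?_⟩)
  rw [bonus, mem_filter, mem_Icc]
  simp only [hn, le_refl, true_and, Act, Survives, Fin.is_lt,
    implies_true, and_true]
  exact ⟨fun i j k h1 h2 h3 h4 => (hσ.1 ⟨i, j, k, h1, h2, h3, h4⟩).elim,
    fun i j h1 h2 h3 => ((h.1 i j h1 h2).not_ge h3).elim⟩

theorem good132_of_subsingleton (σ : Equiv.Perm (Fin 0)) : Good132 σ :=
  ⟨fun ⟨i, _⟩ => i.elim0, fun ⟨i, _⟩ => i.elim0⟩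

theorem siteSum132_zero (u : R) : siteSum132 0 u = u := by
  simp [siteSum132, good132_of_subsingleton, numSites, rank_zero]

theorem siteSum132_succ (n : ℕ) (u : R) :
    siteSum132 (n + 1) u = u * siteSum132 n u + u * extSum132 n u := by
  classical
  rw [siteSum132, siteSum132, extSum132, sum_filter, sum_perm_succ, mul_sum, mul_sum,
    ← sum_add_distrib, sum_filter]
  refine sum_congr rfl fun σ _ => ?_
  simp only [good132_insertLast, numSites_insertLast]
  rw [Fin.sum_univ_eq_sum_range
      (fun v => if Good132 σ ∧ Act132 σ v then u ^ (rank σ v + #(bonus σ v)) else 0)]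
  by_cases hσ : Good132 σ
  · simp only [hσ, true_and, if_true]
    rw [sum_range_succ', sum_filter, sum_range_succ']
    simp only [act132_zero, if_true, rank_zero, card_bonus_zero, ne_eq, not_true, and_false,
      if_false, Nat.add_eq_zero_iff, one_ne_zero, not_false_iff, and_true, add_zero]
    rw [pow_add, pow_one, add_comm, mul_sum]
    congr 1
    refine sum_congr rfl fun v hv => ?_
    split_ifs with h
    · rw [card_bonus_of_act132 hσ (by simpa using hv) (Nat.succ_ne_zero v) h, pow_succ, mul_comm]
    · simp
  · simp [hσ]

theorem extSum132_eq (n : ℕ) (u : R) :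
    extSum132 n u = (if n = 0 then 0 else siteSum132 n u) + innerSum132 n u := by
  classical
  have h : ∀ σ : Equiv.Perm (Fin n), ∑ v ∈ range (n + 1) with Act132 σ v ∧ v ≠ 0, u ^ rank σ v =
      (if n = 0 then 0 else u ^ numSites σ) + ∑ v ∈ range n with Act132 σ v ∧ v ≠ 0, u ^ rank σ v := by
    intro σ
    rw [sum_filter, sum_range_succ, ← sum_filter, add_comm]
    simp only [act132_self, true_and, numSites, ite_not]
  rw [extSum132, sum_congr rfl fun σ _ => h σ, sum_add_distrib, innerSum132, siteSum132]
  split_ifs <;> simp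

/-- If a value that is neither the smallest nor the largest possible one can be appended within
`Av(4123, 132)`, then the last entry is the minimum. -/
theorem last_eq_zero_of_act132 {τ : Equiv.Perm (Fin (n + 1))} {v : ℕ} (hv : v ≠ 0) (hn : v ≤ n)
    (h : Act132 τ v) : τ (Fin.last n) = 0 := by
  by_contra hne
  obtain ⟨i, hi⟩ := τ.surjective 0
  obtain ⟨d, hd⟩ := τ.surjective ⟨v, by omega⟩
  have hi' : (τ i : ℕ) = 0 := by rw [hi]; rfl
  have hd' : (τ d : ℕ) = v := by rw [hd]
  have hil : i < Fin.last n := by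
    refine lt_of_le_of_ne (Fin.le_last i) ?_
    rintro rfl
    exact hne hi
  have hlast := h.1 i (Fin.last n) hil (by omega)
  rcases lt_trichotomy d i with hdi | rfl | hdi
  · have := h.2 d i (Fin.last n) hdi hil (by rw [hi]; exact Fin.pos_of_ne_zero hne) hlast
    omega
  · omega
  · have := h.1 i d hdi (by omega)
    omega

theorem act132_insertLast_zero (σ : Equiv.Perm (Fin n)) (v : ℕ) :
    Act132 (insertLast 0 σ) (v + 1) ↔ Act132 σ v := by
  simp [Act132, forall_fin_succ_last, Fin.not_lt.2 (Fin.le_last _)]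

theorem rank_insertLast_zero (σ : Equiv.Perm (Fin n)) (v : ℕ) :
    rank (insertLast 0 σ) (v + 1) = rank σ v + 1 := by
  classical
  have h : ∀ w, Act (insertLast 0 σ) (w + 1) ↔ Act σ w := fun w => by
    rw [act_insertLast_of_ge 0 σ (by simp)]
    simp [survives_zero]
  simp only [rank, card_filter]
  rw [sum_range_succ']
  simp [h, act_zero]

theorem innerSum132_zero (u : R) : innerSum132 0 u = 0 := by simp [innerSum132]

open Classical in
theorem innerSum132_succ (n : ℕ) (u : R) :
    innerSum132 (n + 1) u = u * innerSum132 n u +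
      if n = 0 then 0 else u ^ 2 * (#{σ : Equiv.Perm (Fin n) | Good132 σ} : R) := by
  have h : ∀ σ : Equiv.Perm (Fin n), ∑ x : Fin (n + 1), (if Good132 (insertLast x σ) then
      ∑ v ∈ range (n + 1) with Act132 (insertLast x σ) v ∧ v ≠ 0, u ^ rank (insertLast x σ) v
      else 0) = if Good132 σ then u * (∑ v ∈ range n with Act132 σ v ∧ v ≠ 0, u ^ rank σ v) +
        (if n = 0 then 0 else u ^ 2) else 0 := by
    intro σ
    rw [Fintype.sum_eq_single 0]
    · rw [sum_filter, sum_range_succ']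
      simp only [good132_insertLast, act132_insertLast_zero, rank_insertLast_zero]
      simp only [Fin.val_zero, act132_zero, and_true, ne_eq, Nat.add_eq_zero_iff, one_ne_zero,
        and_false, not_false_iff, not_true, if_false, add_zero]
      split_ifs with hσ hn
      · subst hn; simp
      · obtain ⟨m, rfl⟩ := Nat.exists_eq_succ_of_ne_zero hn
        rw [sum_filter, mul_sum, sum_range_succ', sum_range_succ']
        simp [act132_zero, rank_zero, pow_succ, mul_comm]
      · rfl
    · intro x hx
      rw [ite_eq_right_iff]
      intro _
      refine sum_eq_zero fun v hv => ?_
      simp only [mem_filter, mem_range] at hv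
      have := last_eq_zero_of_act132 hv.2.2 (by omega) hv.2.1
      rw [insertLast_last] at this
      exact (hx this).elim
  rw [innerSum132, sum_filter, sum_perm_succ, sum_congr rfl fun σ _ => h σ, ← sum_filter,
    sum_add_distrib, innerSum132, mul_sum, sum_const, nsmul_eq_mul]
  split_ifs <;> simp [mul_comm]

end Weights

variable {m q : ℕ}

/-! ### Inverse of the reverse complement -/

/-- The inverse of the reverse complement of `σ`. -/
def revCompInv (σ : Equiv.Perm (Fin n)) : Equiv.Perm (Fin n) :=
  (Fin.revPerm.trans σ.symm).trans Fin.revPerm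

theorem revCompInv_involutive : Function.Involutive (revCompInv (n := n)) := by
  intro σ
  ext i
  simp [revCompInv]

theorem apply_rev_revCompInv (σ : Equiv.Perm (Fin n)) (i : Fin n) :
    σ (Fin.rev (revCompInv σ i)) = Fin.rev i := by
  simp [revCompInv]

theorem Has4123.of_revCompInv {σ : Equiv.Perm (Fin n)} (h : Has4123 (revCompInv σ)) :
    Has4123 σ := by
  obtain ⟨i, j, k, l, hij, hjk, hkl, h1, h2, h3⟩ := h
  refine ⟨_, _, _, _, Fin.rev_lt_rev.2 h3, Fin.rev_lt_rev.2 h2, Fin.rev_lt_rev.2 h1, ?_⟩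
  simp only [apply_rev_revCompInv, Fin.rev_lt_rev]
  exact ⟨hkl, hjk, hij⟩

theorem Has132.of_revCompInv {σ : Equiv.Perm (Fin n)} (h : Has132 (revCompInv σ)) :
    Has213 σ := by
  obtain ⟨i, j, k, hij, hjk, h1, h2⟩ := h
  refine ⟨_, _, _, Fin.rev_lt_rev.2 h2, Fin.rev_lt_rev.2 h1, ?_⟩
  simp only [apply_rev_revCompInv, Fin.rev_lt_rev]
  exact ⟨hjk, hij⟩

theorem Has213.of_revCompInv {σ : Equiv.Perm (Fin n)} (h : Has213 (revCompInv σ)) :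
    Has132 σ := by
  obtain ⟨i, j, k, hij, hjk, h1, h2⟩ := h
  refine ⟨_, _, _, Fin.rev_lt_rev.2 h2, Fin.rev_lt_rev.2 h1, ?_⟩
  simp only [apply_rev_revCompInv, Fin.rev_lt_rev]
  exact ⟨hjk, hij⟩

open Classical in
theorem card_good213 (n : ℕ) :
    #{σ : Equiv.Perm (Fin n) | Good213 σ} = #{σ : Equiv.Perm (Fin n) | Good132 σ} := by
  refine card_nbij' revCompInv revCompInv ?_ ?_ (fun σ _ => revCompInv_involutive σ)
    (fun σ _ => revCompInv_involutive σ)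
  · intro σ hσ
    simp only [coe_filter, mem_univ, true_and] at hσ ⊢
    exact ⟨fun h => hσ.1 h.of_revCompInv, fun h => hσ.2 h.of_revCompInv⟩
  · intro σ hσ
    simp only [coe_filter, mem_univ, true_and] at hσ ⊢
    exact ⟨fun h => hσ.1 h.of_revCompInv, fun h => hσ.2 h.of_revCompInv⟩

/-! ### Direct sums -/

/-- The direct sum of two permutations: `S` on the first `m` positions and values, and `Q` on the
last `q` ones. -/
def directSum (S : Equiv.Perm (Fin m)) (Q : Equiv.Perm (Fin q)) : Equiv.Perm (Fin (m + q)) :=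
  finSumFinEquiv.permCongr (Equiv.sumCongr S Q)

@[simp] theorem directSum_castAdd (S : Equiv.Perm (Fin m)) (Q : Equiv.Perm (Fin q)) (i : Fin m) :
    directSum S Q (Fin.castAdd q i) = Fin.castAdd q (S i) := by
  simp [directSum, Equiv.permCongr_apply]

@[simp] theorem directSum_natAdd (S : Equiv.Perm (Fin m)) (Q : Equiv.Perm (Fin q)) (j : Fin q) :
    directSum S Q (Fin.natAdd m j) = Fin.natAdd m (Q j) := by
  simp [directSum, Equiv.permCongr_apply]

theorem directSum_injective : Function.Injective
    fun p : Equiv.Perm (Fin m) × Equiv.Perm (Fin q) => directSum p.1 p.2 := by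
  rintro ⟨S, Q⟩ ⟨S', Q'⟩ h
  have h' : ∀ x, directSum S Q x = directSum S' Q' x := fun x => DFunLike.congr_fun h x
  obtain rfl : S = S' := by
    ext i
    simpa [Fin.ext_iff] using h' (Fin.castAdd q i)
  obtain rfl : Q = Q' := by
    ext i
    simpa [Fin.ext_iff] using h' (Fin.natAdd m i)
  rfl

theorem exists_eq_directSum (σ : Equiv.Perm (Fin (m + q)))
    (h : ∀ x : Fin (m + q), (x : ℕ) < m → (σ x : ℕ) < m) : ∃ S Q, directSum S Q = σ := by
  have hr := Equiv.Perm.mem_sumCongrHom_range_of_perm_mapsTo_inl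
    (σ := (finSumFinEquiv (m := m) (n := q)).symm.permCongr σ) (by
      rintro _ ⟨i, rfl⟩
      have hi := h (Fin.castAdd q i) i.2
      refine ⟨⟨_, hi⟩, ?_⟩
      rw [Equiv.permCongr_apply, Equiv.eq_symm_apply]
      simp)
  obtain ⟨⟨S, Q⟩, hSQ⟩ := hr
  refine ⟨S, Q, ?_⟩
  ext x
  have := DFunLike.congr_fun hSQ (finSumFinEquiv.symm x)
  simp only [Equiv.permCongr_apply, Equiv.symm_symm, Equiv.apply_symm_apply] at this
  rw [Fin.ext_iff.1 ((Equiv.symm_apply_eq _).1 this.symm)]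
  rfl

/-- If all values below `m` come before all other values, they fill the first `m` positions. -/
theorem val_lt_of_separated (σ : Equiv.Perm (Fin (m + q)))
    (h : ∀ x y, (σ x : ℕ) < m → m ≤ σ y → x < y) (x : Fin (m + q)) (hx : (x : ℕ) < m) :
    (σ x : ℕ) < m := by
  by_contra hlt
  have hcard : #(Finset.Ici x) ≤ #(Finset.Ici (⟨m, by
      have := (σ x).2; omega⟩ : Fin (m + q))) := by
    refine card_le_card_of_injOn σ ?_ σ.injective.injOn
    intro y hy
    simp only [coe_Ici, Set.mem_Ici, Fin.le_def] at hy ⊢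
    by_contra hy'
    have := h y x (by simpa using hy') (by omega)
    rw [Fin.lt_def] at this
    omega
  rw [Fin.card_Ici, Fin.card_Ici] at hcard
  simp only at hcard
  omega

section

variable (S : Equiv.Perm (Fin m)) (Q : Equiv.Perm (Fin q))

theorem directSum_lt_iff (x : Fin (m + q)) : (directSum S Q x : ℕ) < m ↔ (x : ℕ) < m := by
  induction x using Fin.addCases <;> simp

theorem exists_castAdd {x : Fin (m + q)} (h : (x : ℕ) < m) : ∃ i, Fin.castAdd q i = x :=
  ⟨⟨x, h⟩, rfl⟩

theorem exists_natAdd {x : Fin (m + q)} (h : m ≤ (x : ℕ)) : ∃ j, Fin.natAdd m j = x :=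
  ⟨⟨x - m, by omega⟩, by ext; simp; omega⟩

theorem act_directSum {w : ℕ} (hw : w ≤ m) : Act (directSum S Q) w ↔ Act S w := by
  constructor
  · rintro ⟨h1, h2⟩
    refine ⟨fun i j k hij hjk a b => ?_, fun i j k hij hjk a b => ?_⟩
    · simpa using h1 (Fin.castAdd q i) (Fin.castAdd q j) (Fin.castAdd q k) hij hjk
        (by rwa [directSum_castAdd, directSum_castAdd]) (by rwa [directSum_castAdd, directSum_castAdd])
    · simpa using h2 (Fin.castAdd q i) (Fin.castAdd q j) (Fin.castAdd q k) hij hjk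
        (by rwa [directSum_castAdd, directSum_castAdd]) (by rwa [directSum_castAdd])
  · rintro ⟨h1, h2⟩
    refine ⟨fun i j k hij hjk a b => ?_, fun i j k hij hjk a b => ?_⟩
    · by_contra hlt
      have hj := (directSum_lt_iff S Q j).1 (by omega)
      have hk := (directSum_lt_iff S Q k).1 (by rw [Fin.lt_def] at b; omega)
      obtain ⟨i, rfl⟩ := exists_castAdd (q := q) (x := i) (by rw [Fin.lt_def] at hij; omega)
      obtain ⟨j, rfl⟩ := exists_castAdd hj
      obtain ⟨k, rfl⟩ := exists_castAdd hk
      simp only [directSum_castAdd] at a b hlt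
      exact hlt (h1 i j k hij hjk a b)
    · have hk := (directSum_lt_iff S Q k).1 (by omega)
      rw [Fin.lt_def] at hij hjk
      obtain ⟨i, rfl⟩ := exists_castAdd (q := q) (x := i) (by omega)
      obtain ⟨j, rfl⟩ := exists_castAdd (q := q) (x := j) (by omega)
      obtain ⟨k, rfl⟩ := exists_castAdd hk
      simp only [directSum_castAdd] at a b ⊢
      exact h2 i j k hij hjk a b

theorem rank_directSum {v : ℕ} (hv : v ≤ m) : rank (directSum S Q) v = rank S v := by
  classical
  simp only [rank]
  congr 1
  refine filter_congr fun w hw => act_directSum S Q ?_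
  rw [mem_range] at hw
  omega

theorem good_directSum (hS : Good132 S) (hQ : Good213 Q) : Good (directSum S Q) := by
  have hlt := directSum_lt_iff S Q
  constructor
  · rintro ⟨i, j, k, l, hij, hjk, hkl, h1, h2, h3⟩
    by_cases hj : (j : ℕ) < m
    · have hjv := (hlt j).2 hj
      obtain ⟨k, rfl⟩ := exists_castAdd ((hlt k).1 (by rw [Fin.lt_def] at h2; omega))
      obtain ⟨i, rfl⟩ := exists_castAdd (q := q) (x := i) (by rw [Fin.lt_def] at hij; omega)
      obtain ⟨j, rfl⟩ := exists_castAdd hj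
      simp only [directSum_castAdd] at h1 h2
      exact hS.1 ⟨i, j, k, hij, hjk, h1, h2⟩
    · rw [Fin.lt_def] at hjk hkl
      obtain ⟨j, rfl⟩ := exists_natAdd (x := j) (by omega)
      obtain ⟨k, rfl⟩ := exists_natAdd (x := k) (by omega)
      obtain ⟨l, rfl⟩ := exists_natAdd (x := l) (by omega)
      simp only [directSum_natAdd, Fin.natAdd_lt_natAdd_iff] at h2 h3
      exact hQ.1 ⟨j, k, l, by simpa using hjk, by simpa using hkl, h2, h3⟩
  · rintro ⟨i, j, k, l, hij, hjk, hkl, h1, h2, h3⟩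
    by_cases hi : (i : ℕ) < m
    · have hiv := (hlt i).2 hi
      rw [Fin.lt_def] at h1 h2 h3
      obtain ⟨i, rfl⟩ := exists_castAdd hi
      obtain ⟨j, rfl⟩ := exists_castAdd ((hlt j).1 (by omega))
      obtain ⟨k, rfl⟩ := exists_castAdd ((hlt k).1 (by omega))
      obtain ⟨l, rfl⟩ := exists_castAdd ((hlt l).1 (by omega))
      simp only [directSum_castAdd] at h1 h2 h3
      exact hS.2 ⟨i, j, k, l, hij, hjk, hkl, h1, h2, h3⟩
    · rw [Fin.lt_def] at hij hjk hkl
      obtain ⟨i, rfl⟩ := exists_natAdd (x := i) (by omega)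
      obtain ⟨j, rfl⟩ := exists_natAdd (x := j) (by omega)
      obtain ⟨k, rfl⟩ := exists_natAdd (x := k) (by omega)
      obtain ⟨l, rfl⟩ := exists_natAdd (x := l) (by omega)
      simp only [directSum_natAdd, Fin.natAdd_lt_natAdd_iff] at h1 h2 h3
      exact hQ.2 ⟨i, j, k, l, by simpa using hij, by simpa using hjk, by simpa using hkl, h1, h2, h3⟩

theorem act_of_act132 (hS : Good132 S) {v : ℕ} (h : Act132 S v) : Act S v :=
  ⟨fun i j k h1 h2 h3 h4 => (hS.1 ⟨i, j, k, h1, h2, h3, h4⟩).elim, h.2⟩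

theorem survives_directSum {v : ℕ} (hv : v ≤ m) (h : Act132 S v) :
    Survives (directSum S Q) v m := by
  have hlt := directSum_lt_iff S Q
  constructor
  · intro i j hij hi hj
    by_contra hj'
    obtain ⟨i, rfl⟩ := exists_castAdd ((hlt i).1 (by omega))
    obtain ⟨j, rfl⟩ := exists_castAdd ((hlt j).1 (by omega))
    simp only [directSum_castAdd, Fin.val_castAdd] at hi hj
    exact (h.1 i j hij hi).not_ge hj
  · intro i j hij hj _
    have := (hlt j).1 (by omega)
    rw [hlt]
    rw [Fin.lt_def] at hij
    omega

/-- Bonus sites `w` come exactly from the direct sums `S ⊕ Q` with `w = |S|`, where `S` avoids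
`132`, still does so after `v` is appended, and `Q` avoids `213`. -/
theorem bonus_directSum_iff {v : ℕ} (hv0 : v ≠ 0) (hv : v ≤ m) :
    (Good (directSum S Q) ∧ Act (directSum S Q) v ∧ Act (directSum S Q) m ∧
      Survives (directSum S Q) v m) ↔ (Good132 S ∧ Act132 S v) ∧ Good213 Q := by
  constructor
  · rintro ⟨hg, hav, ham, hs⟩
    refine ⟨⟨⟨?_, ?_⟩, ?_, ?_⟩, ?_, ?_⟩
    · rintro ⟨i, j, k, hij, hjk, h1, h2⟩
      have := ham.1 (Fin.castAdd q i) (Fin.castAdd q j) (Fin.castAdd q k) hij hjk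
        (by rwa [directSum_castAdd, directSum_castAdd])
        (by rwa [directSum_castAdd, directSum_castAdd])
      simp only [directSum_castAdd, Fin.val_castAdd] at this
      omega
    · rintro ⟨i, j, k, l, hij, hjk, hkl, h1, h2, h3⟩
      exact hg.2 ⟨Fin.castAdd q i, Fin.castAdd q j, Fin.castAdd q k, Fin.castAdd q l, hij, hjk, hkl,
        by rwa [directSum_castAdd, directSum_castAdd],
        by rwa [directSum_castAdd, directSum_castAdd],
        by rwa [directSum_castAdd, directSum_castAdd]⟩
    · intro i j hij hi
      by_contra hj
      have := hs.1 (Fin.castAdd q i) (Fin.castAdd q j) hij (by simpa using hi) (by simpa using hj)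
      simp only [directSum_castAdd, Fin.val_castAdd] at this
      omega
    · exact ((act_directSum S Q hv).1 hav).2
    · rintro ⟨i, j, k, hij, hjk, h1, h2⟩
      let z : Fin m := S.symm ⟨0, by omega⟩
      refine hg.1 ⟨Fin.castAdd q z, Fin.natAdd m i, Fin.natAdd m j, Fin.natAdd m k, ?_,
        by simpa using hij, by simpa using hjk, ?_, by simpa using h1, by simpa using h2⟩
      · simp [Fin.lt_def]; omega
      · simp [Fin.lt_def, z]; omega
    · rintro ⟨i, j, k, l, hij, hjk, hkl, h1, h2, h3⟩
      exact hg.2 ⟨Fin.natAdd m i, Fin.natAdd m j, Fin.natAdd m k, Fin.natAdd m l, by simpa using hij,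
        by simpa using hjk, by simpa using hkl, by simpa using h1, by simpa using h2,
        by simpa using h3⟩
  · rintro ⟨⟨hS, ha⟩, hQ⟩
    exact ⟨good_directSum S Q hS hQ, (act_directSum S Q hv).2 (act_of_act132 S hS ha),
      (act_directSum S Q le_rfl).2 (act_of_act132 S hS (act132_self S)),
      survives_directSum S Q hv ha⟩

end

theorem exists_eq_directSum_of_survives (σ : Equiv.Perm (Fin (m + q))) {v : ℕ} (hv0 : v ≠ 0)
    (hv : v ≤ m) (h : Survives σ v m) : ∃ S Q, directSum S Q = σ := by
  refine exists_eq_directSum σ (val_lt_of_separated σ fun x y hx hy => ?_)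
  obtain ⟨z, hz⟩ := σ.surjective ⟨0, by omega⟩
  have hz' : (σ z : ℕ) = 0 := by rw [hz]
  -- every value from `m` on comes after every value below `v`
  have key : ∀ a, (σ a : ℕ) < v → a < y := fun a ha => by
    rcases lt_trichotomy a y with h' | rfl | h'
    · exact h'
    · omega
    · have := h.2 y a h' ha (by omega)
      omega
  rcases lt_or_ge (σ x : ℕ) v with hxv | hxv
  · exact key x hxv
  · have : x < z := by
      rcases lt_trichotomy x z with h' | rfl | h'
      · exact h'
      · omega
      · have := h.1 z x h' (by omega) hxv
        omega
    exact this.trans (key z (by omega))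

section

variable {R : Type*} [CommRing R]

open Classical in
/-- The part of `bonusSum` where the surviving site is `m`. -/
theorem sum_survives_eq (m q n : ℕ) (hn : m + q = n) (u : R) :
    ∑ σ : Equiv.Perm (Fin n) with Good σ,
      ∑ v ∈ range (m + 1) with Act σ v ∧ v ≠ 0,
        (if Act σ m ∧ Survives σ v m then u ^ rank σ v else 0) =
      extSum132 m u * (#{σ : Equiv.Perm (Fin q) | Good132 σ} : R) := by
  subst hn
  rw [sum_filter]
  simp only [sum_filter]
  have h0 : ∀ (σ : Equiv.Perm (Fin (m + q))), σ ∉ Set.range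
      (fun p : Equiv.Perm (Fin m) × Equiv.Perm (Fin q) => directSum p.1 p.2) →
      (if Good σ then ∑ v ∈ range (m + 1), if Act σ v ∧ v ≠ 0 then
        (if Act σ m ∧ Survives σ v m then u ^ rank σ v else 0) else 0 else 0) = 0 := by
    intro σ hσ
    rw [ite_eq_right_iff]
    intro _
    refine sum_eq_zero fun v hv => ?_
    rw [mem_range] at hv
    rw [ite_eq_right_iff]
    rintro ⟨_, hv0⟩
    rw [if_neg]
    rintro ⟨-, hs⟩
    obtain ⟨S, Q, rfl⟩ := exists_eq_directSum_of_survives σ hv0 (by omega) hs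
    exact hσ ⟨(S, Q), rfl⟩
  rw [← Fintype.sum_of_injective _ directSum_injective
    (fun p : Equiv.Perm (Fin m) × Equiv.Perm (Fin q) =>
      if Good213 p.2 then (if Good132 p.1 then
        ∑ v ∈ range (m + 1), if Act132 p.1 v ∧ v ≠ 0 then u ^ rank p.1 v else 0 else 0) else 0)
    _ h0]
  · rw [Fintype.sum_prod_type_right, ← card_good213, extSum132, card_filter, Nat.cast_sum, mul_sum]
    refine sum_congr rfl fun Q _ => ?_
    by_cases hQ : Good213 Q <;> simp [hQ, sum_filter]
  · rintro ⟨S, Q⟩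
    have key : ∀ v ∈ range (m + 1), (if Good (directSum S Q) ∧ Act (directSum S Q) v ∧ v ≠ 0 ∧
        Act (directSum S Q) m ∧ Survives (directSum S Q) v m then u ^ rank (directSum S Q) v else 0)
        = if Good213 Q ∧ Good132 S ∧ Act132 S v ∧ v ≠ 0 then u ^ rank S v else 0 := by
      intro v hv
      have hv : v ≤ m := by simpa [Nat.lt_succ_iff] using hv
      rw [rank_directSum S Q hv]
      refine if_congr ?_ rfl rfl
      by_cases hv0 : v = 0
      · simp [hv0]
      · have := bonus_directSum_iff S Q hv0 hv
        tauto
    have := sum_congr rfl key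
    simp only [ite_and] at this ⊢
    by_cases h1 : Good213 Q <;> by_cases h2 : Good132 S <;> by_cases h3 : Good (directSum S Q) <;>
      first | (simp [h1, h2, h3]; done) | simpa [h1, h2, h3] using this.symm

open Classical in
theorem bonusSum_eq (n : ℕ) (u : R) :
    bonusSum n u = ∑ p ∈ antidiagonal n,
      extSum132 p.1 u * (#{σ : Equiv.Perm (Fin p.2) | Good132 σ} : R) := by
  rw [← sum_congr rfl fun p hp => sum_survives_eq p.1 p.2 n (mem_antidiagonal.1 hp) u]
  rw [bonusSum, sum_comm]
  refine sum_congr rfl fun σ _ => ?_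
  rw [Nat.sum_antidiagonal_eq_sum_range_succ_mk]
  rw [sum_comm' (t' := range (n + 1)) (s' := fun m => {v ∈ range (m + 1) | Act σ v ∧ v ≠ 0 ∧
    Act σ m ∧ Survives σ v m})]
  · refine sum_congr rfl fun m _ => ?_
    rw [← sum_filter, filter_filter]
    simp only [and_assoc]
  · intro v w
    simp only [mem_filter, mem_range, bonus, mem_Icc]
    grind

end

/-! ### Summing a sequence of power series -/

section Diag

variable {R : Type*} [CommRing R]

/-- The power series `∑ₙ Xⁿ fₙ`, for a sequence `f` of power series. -/
noncomputable def diag (f : ℕ → PowerSeries R) : PowerSeries R :=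
  PowerSeries.mk fun N => ∑ p ∈ antidiagonal N, coeff p.2 (f p.1)

theorem coeff_diag (f : ℕ → PowerSeries R) (N : ℕ) :
    coeff N (diag f) = ∑ p ∈ antidiagonal N, coeff p.2 (f p.1) := coeff_mk _ _

theorem diag_succ (f : ℕ → PowerSeries R) : diag f = f 0 + X * diag fun n => f (n + 1) := by
  ext N
  cases N with
  | zero => simp [coeff_diag]
  | succ N => rw [map_add, coeff_succ_X_mul, coeff_diag, coeff_diag,
      Nat.sum_antidiagonal_succ]

theorem diag_add (f g : ℕ → PowerSeries R) : diag (fun n => f n + g n) = diag f + diag g := by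
  ext N
  simp [coeff_diag, sum_add_distrib]

/-- A Cauchy product with a sequence of constants becomes a product of power series. -/
theorem diag_conv (f : ℕ → PowerSeries R) (q : ℕ → R) :
    diag (fun n => ∑ p ∈ antidiagonal n, f p.1 * C (q p.2)) = diag f * PowerSeries.mk q := by
  ext N
  simp only [coeff_diag, coeff_mul _ (diag f), coeff_mk, map_sum, coeff_mul_C, sum_mul]
  rw [sum_sigma', sum_sigma']
  refine sum_nbij' (fun x => ⟨(x.2.1 + x.1.2, x.2.2), (x.2.1, x.1.2)⟩)
    (fun x => ⟨(x.2.1 + x.1.2, x.2.2), (x.2.1, x.1.2)⟩) ?_ ?_ ?_ ?_ ?_ <;>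
  · rintro ⟨⟨a, b⟩, c, d⟩ h
    simp only [mem_sigma, HasAntidiagonal.mem_antidiagonal] at h
    obtain ⟨rfl, rfl⟩ := h
    simp [add_right_comm]

theorem diag_mul_left (a : PowerSeries R) (f : ℕ → PowerSeries R) :
    diag (fun n => a * f n) = a * diag f := by
  ext N
  simp only [coeff_diag, coeff_mul, mul_sum]
  rw [sum_sigma', sum_sigma']
  refine sum_nbij' (fun x => ⟨(x.2.1, x.1.1 + x.2.2), (x.1.1, x.2.2)⟩)
    (fun x => ⟨(x.2.1, x.1.1 + x.2.2), (x.1.1, x.2.2)⟩) ?_ ?_ ?_ ?_ ?_ <;>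
  · rintro ⟨⟨a, b⟩, c, d⟩ h
    simp only [mem_sigma, HasAntidiagonal.mem_antidiagonal] at h
    obtain ⟨rfl, rfl⟩ := h
    simp [add_left_comm]

theorem diag_C (p : ℕ → R) : diag (fun n => C (p n)) = PowerSeries.mk p := by
  ext N
  rw [coeff_diag, coeff_mk, sum_eq_single (N, 0)]
  · simp
  · rintro ⟨i, j⟩ hp hne
    rw [HasAntidiagonal.mem_antidiagonal] at hp
    rw [coeff_C, if_neg]
    rintro rfl
    exact hne (by simpa using hp)
  · simp

end Diag

/-! ### The generating functions -/

/-- The generating function of the Catalan numbers, as the quotient `(1 - √(1 - 4X)) / (2X)`. -/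
theorem exists_catalan :
    ∃ c : PowerSeries ℚ, sqrtOneSubFour = 1 - 2 * X * c ∧ X * c ^ 2 = c - 1 := by
  obtain ⟨d, hd⟩ := X_dvd_iff.2 (show constantCoeff (1 - sqrtOneSubFour) = 0 by
    rw [map_sub, constantCoeff_sqrtOneSubFour]; simp)
  have h2 : (2 : PowerSeries ℚ) * C (1 / 2 : ℚ) = 1 := by
    rw [show (2 : PowerSeries ℚ) = C (2 : ℚ) from (map_ofNat _ 2).symm, ← map_mul]
    norm_num
  have hs : sqrtOneSubFour = 1 - 2 * X * (C (1 / 2 : ℚ) * d) := by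
    linear_combination -hd + X * d * h2
  refine ⟨C (1 / 2 : ℚ) * d, hs, ?_⟩
  generalize C (1 / 2 : ℚ) * d = c at hs
  have h := sqrtOneSubFour_sq
  rw [hs] at h
  have four_ne_zero : (4 : PowerSeries ℚ) ≠ 0 := fun h0 => by
    have := congrArg constantCoeff h0
    rw [map_ofNat, map_zero] at this
    norm_num at this
  have h4 : (4 * X : PowerSeries ℚ) ≠ 0 := mul_ne_zero four_ne_zero X_ne_zero
  apply mul_left_cancel₀ h4
  linear_combination h

open Classical in
/-- The generating function of `Av(4123, 132)`. -/
noncomputable def genFun132 : PowerSeries ℚ :=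
  PowerSeries.mk fun n => (#{σ : Equiv.Perm (Fin n) | Good132 σ} : ℚ)

open Classical in
theorem genFun_eq : genFun (Av {p4123, p1324}) =
    PowerSeries.mk fun n => (#{σ : Equiv.Perm (Fin n) | Good σ} : ℚ) := by
  unfold genFun
  congr 1
  ext n
  simp only [mem_Av_iff]
  rw [Nat.card_eq_fintype_card, Fintype.card_subtype]

theorem diag_siteSum132 (u : PowerSeries ℚ) :
    diag (siteSum132 · u) =
      u + X * (u * diag (siteSum132 · u) + u * diag (extSum132 · u)) := by
  conv_lhs => rw [diag_succ]
  simp only [siteSum132_succ, diag_add, diag_mul_left, siteSum132_zero]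

theorem diag_extSum132 (u : PowerSeries ℚ) :
    diag (extSum132 · u) = diag (siteSum132 · u) - u + diag (innerSum132 · u) := by
  simp only [extSum132_eq]
  rw [diag_add]
  conv_lhs => rw [diag_succ]
  conv_rhs => rw [diag_succ]
  simp [siteSum132_zero]

theorem diag_innerSum132 (u : PowerSeries ℚ) :
    diag (innerSum132 · u) = X * (u * diag (innerSum132 · u) + u ^ 2 * (genFun132 - 1)) := by
  classical
  conv_lhs => rw [diag_succ]
  have h : (fun n => innerSum132 (n + 1) u) = fun n => u * innerSum132 n u +
      u ^ 2 * C (if n = 0 then 0 else (#{σ : Equiv.Perm (Fin n) | Good132 σ} : ℚ)) := by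
    ext1 n
    rw [innerSum132_succ]
    split_ifs <;> simp
  rw [h, diag_add, diag_mul_left, diag_mul_left, diag_C, innerSum132_zero, zero_add]
  congr 4
  ext n
  rw [map_sub, genFun132, coeff_mk, coeff_mk, coeff_one]
  split_ifs with hn
  · subst hn
    simp [good132_of_subsingleton]
  · simp

theorem diag_siteSum132_one : diag (siteSum132 · (1 : PowerSeries ℚ)) = genFun132 := by
  classical
  rw [genFun132, ← diag_C]
  congr 1
  ext1 n
  simp [siteSum132]

/-- For `u = 1` the functional equations determine the generating function of `Av(4123, 132)`. -/
theorem genFun132_mul : genFun132 * (1 - 3 * X + X ^ 2) = 1 - 2 * X := by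
  have h1 := diag_siteSum132 1
  have h2 := diag_extSum132 1
  have h3 := diag_innerSum132 1
  rw [diag_siteSum132_one] at h1 h2
  linear_combination (1 - X) * h1 + X * (1 - X) * h2 + X * h3

/-- The kernel method: for `u = c` the unknown series `diag (siteSum · c)` drops out of the functional
equation that `siteSum_succ` gives. -/
theorem genFun_eq_of_catalan {c : PowerSeries ℚ} (hc : X * c ^ 2 = c - 1) :
    genFun (Av {p4123, p1324}) = c + X * (c - 1) * diag (extSum132 · c) * genFun132 := by
  classical
  have hc1 : c - 1 ≠ 0 := fun h0 => X_ne_zero (R := ℚ) (by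
    rwa [h0, sub_eq_zero.1 h0, one_pow, mul_one] at hc)
  have h1 : diag (siteSum · c) = c + X * diag (fun n => siteSum (n + 1) c) := by
    conv_lhs => rw [diag_succ]
    simp only [siteSum_zero]
  have h2 : (c - 1) * diag (fun n => siteSum (n + 1) c) + c ^ 2 * genFun (Av {p4123, p1324}) =
      c ^ 2 * diag (siteSum · c) + (c - 1) ^ 2 * (diag (extSum132 · c) * genFun132) := by
    rw [genFun_eq, genFun132, ← diag_C, ← diag_conv, ← diag_mul_left, ← diag_mul_left,
      ← diag_mul_left, ← diag_mul_left, ← diag_add, ← diag_add]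
    congr 1
    ext1 n
    have := siteSum_succ n c
    rw [bonusSum_eq] at this
    simp only [map_natCast]
    linear_combination this
  apply mul_left_cancel₀ hc1
  -- `c² X = c - 1` makes the coefficients of `diag (siteSum · c)` on both sides equal
  linear_combination X * h2 + (c - 1) * h1 +
    (diag (siteSum · c) - genFun (Av {p4123, p1324})) * hc

/-- The closed form of the generating function of `Av(4123, 1324)`, without the division. -/
theorem genFun_mul :
    genFun (Av {p4123, p1324}) * (2 * sqrtOneSubFour * (1 - 3 * X + X ^ 2) ^ 2) =
      2 - 13 * X + 26 * X ^ 2 - 17 * X ^ 3 + 4 * X ^ 4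
        - X * (1 - 2 * X - X ^ 2) * sqrtOneSubFour := by
  obtain ⟨c, hs, hc⟩ := exists_catalan
  have hG := diag_siteSum132 c
  have hT := diag_extSum132 c
  have hH := diag_innerSum132 c
  have hQ := genFun132_mul
  have hP := genFun_eq_of_catalan hc
  rw [hs, hP]
  generalize diag (siteSum132 · c) = G at *
  generalize diag (extSum132 · c) = T at *
  generalize diag (innerSum132 · c) = H at *
  generalize genFun132 = Q at *
  have hH' : H = c * (c - 1) * (Q - 1) := by
    linear_combination c * hH + (H + c * (Q - 1)) * hc
  have hG' : G * (1 - 2 * X * c) = 1 + X * c * H := by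
    linear_combination hG + X * c * hT - hc
  have hT' : T * (1 - 2 * X * c) * (1 - 3 * X + X ^ 2) = (c - 1) * (1 - 2 * X) := by
    linear_combination (1 - 3 * X + X ^ 2) * (1 - 2 * X * c) * hT + (1 - 3 * X + X ^ 2) * hG' +
      (1 - 3 * X + X ^ 2) * (1 - X * c) * hH' + c * (c - 1) * (1 - X * c) * hQ +
      (2 * (1 - 3 * X + X ^ 2) - (c - 1) * (X - X ^ 2)) * hc
  linear_combination 2 * X * (c - 1) * Q * (1 - 3 * X + X ^ 2) * hT' +
    2 * X * (c - 1) ^ 2 * (1 - 2 * X) * hQ + (2 * (1 - 2 * X) ^ 2 - 4 * (1 - 3 * X + X ^ 2) ^ 2) * hc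

/-! ### The algebraic degree -/

theorem polynomial_coe_ofNat (k : ℕ) [k.AtLeastTwo] :
    ((OfNat.ofNat k : Polynomial ℚ) : PowerSeries ℚ) = OfNat.ofNat k :=
  map_ofNat Polynomial.coeToPowerSeries.ringHom k

theorem natDegree_one_sub_four_mul_X : (1 - 4 * Polynomial.X : Polynomial ℚ).natDegree = 1 := by
  compute_degree!

theorem one_sub_four_mul_X_ne_zero : (1 - 4 * Polynomial.X : Polynomial ℚ) ≠ 0 := fun h => by
  simpa [h] using natDegree_one_sub_four_mul_X

/-- `√(1 - 4X)` is not a quotient of two polynomials, as `1 - 4X` has odd degree. -/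
theorem sqrtOneSubFour_mul_ne {p q : Polynomial ℚ} (hq : q ≠ 0) :
    sqrtOneSubFour * (p : PowerSeries ℚ) ≠ q := by
  intro h
  have h2 : (1 - 4 * Polynomial.X) * p ^ 2 = q ^ 2 := by
    apply Polynomial.coe_injective ℚ
    push_cast
    rw [← h, mul_pow, sqrtOneSubFour_sq, polynomial_coe_ofNat]
  have hp : p ≠ 0 := by
    rintro rfl
    exact hq (by simpa using h2.symm)
  have := congrArg Polynomial.natDegree h2
  rw [Polynomial.natDegree_mul one_sub_four_mul_X_ne_zero (pow_ne_zero 2 hp),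
    natDegree_one_sub_four_mul_X, Polynomial.natDegree_pow,
    Polynomial.natDegree_pow] at this
  omega

/-- A power series `f` with `√(1 - 4X) (d f + b) = a`, where `a`, `b`, `d` are polynomials with
`a, d ≠ 0`, is algebraic of degree two: squaring gives a quadratic equation, and a linear one would
make `√(1 - 4X)` a quotient of polynomials. -/
theorem isAlgebraicOfDegree_two {f : PowerSeries ℚ} {a b d : Polynomial ℚ} (ha : a ≠ 0)
    (hd : d ≠ 0) (h : sqrtOneSubFour * ((d : PowerSeries ℚ) * f + b) = a) :
    IsAlgebraicOfDegree f 2 := by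
  have hs := sqrtOneSubFour_sq
  have hC : ∀ p : Polynomial ℚ, algebraMap (Polynomial ℚ) (PowerSeries ℚ) p = p := fun p => by
    simp [PowerSeries.algebraMap_apply']
  constructor
  · have hdeg := Polynomial.natDegree_quadratic
      (b := (1 - 4 * Polynomial.X) * (2 * d * b)) (c := (1 - 4 * Polynomial.X) * b ^ 2 - a ^ 2)
      (mul_ne_zero one_sub_four_mul_X_ne_zero (pow_ne_zero 2 hd))
    refine ⟨_, fun h0 => ?_, hdeg, ?_⟩
    · rw [h0, Polynomial.natDegree_zero] at hdeg
      omega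
    · simp only [map_add, map_mul, Polynomial.aeval_C, Polynomial.aeval_X, map_pow, hC]
      push_cast
      rw [← h, polynomial_coe_ofNat, polynomial_coe_ofNat]
      linear_combination -((d : PowerSeries ℚ) * f + b) ^ 2 * hs
  · rintro k ⟨Q, hQ, rfl, hf⟩
    by_contra hk
    obtain ⟨c₁, c₀, rfl⟩ := Polynomial.exists_eq_X_add_C_of_natDegree_le_one
      (show Q.natDegree ≤ 1 by omega)
    simp only [map_add, map_mul, Polynomial.aeval_C, Polynomial.aeval_X, hC] at hf
    by_cases hc : c₁ = 0
    · subst hc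
      have : c₀ = 0 := Polynomial.coe_injective ℚ (by simpa using hf)
      simp [this] at hQ
    · refine sqrtOneSubFour_mul_ne (p := b * c₁ - d * c₀) (q := a * c₁) (mul_ne_zero ha hc) ?_
      push_cast
      linear_combination (c₁ : PowerSeries ℚ) * h - sqrtOneSubFour * d * hf

end PermClass

theorem theorem1 :
    PermClass.genFun (PermClass.Av {PermClass.p4123, PermClass.p1324}) =
        (2 - 13 * X + 26 * X ^ 2 - 17 * X ^ 3 + 4 * X ^ 4
            - X * (1 - 2 * X - X ^ 2) * PermClass.sqrtOneSubFour)
          * (2 * PermClass.sqrtOneSubFour * (1 - 3 * X + X ^ 2) ^ 2)⁻¹ ∧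
      PermClass.IsAlgebraicOfDegree
        (PermClass.genFun (PermClass.Av {PermClass.p4123, PermClass.p1324})) 2 := by
  constructor
  · rw [PowerSeries.eq_mul_inv_iff_mul_eq]
    · exact PermClass.genFun_mul
    · simp [PermClass.constantCoeff_sqrtOneSubFour, map_ofNat constantCoeff 2]
  · refine PermClass.isAlgebraicOfDegree_two
      (a := 2 - 13 * Polynomial.X + 26 * Polynomial.X ^ 2 - 17 * Polynomial.X ^ 3
        + 4 * Polynomial.X ^ 4)
      (b := Polynomial.X * (1 - 2 * Polynomial.X - Polynomial.X ^ 2))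
      (d := 2 * (1 - 3 * Polynomial.X + Polynomial.X ^ 2) ^ 2) ?_ ?_ ?_
    · intro h
      simpa using congrArg (Polynomial.eval 0) h
    · intro h
      simpa using congrArg (Polynomial.eval 0) h
    · have := PermClass.genFun_mul
      have hX : Polynomial.coeToPowerSeries.ringHom Polynomial.X = (X : PowerSeries ℚ) := by simp
      simp only [← Polynomial.coeToPowerSeries.ringHom_apply, map_add, map_sub, map_mul, map_pow,
        map_one, map_ofNat, hX]
      linear_combination this
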